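/- A matrix Lie group is a closed subgroup $G$ of $GL(m,\mathbb{C})$ for some $m\ge 0$ (closed in $GL(m,\mathbb{C})$). Its Lie algebra $\mathfrak{g}$ is the tangent space of $G$ at the identity, i.e. the real vector space of all matrices $\gamma'(0)$, where $\gamma:\mathbb{R}\to G$ is a smooth curve with $\gamma(0)=1$, and $\exp:\mathfrak{g}\to G$ is the matrix exponential. A one-parameter subgroup of a Lie group $H$ is a continuous map $\gamma:\mathbb{R}\to H$ with $\gamma(0)=1$ and $\gamma(s+t)=\gamma(s)\gamma(t)$ for all $s,t\in\mathbb{R}$. A map $f:\mathbb{R}^d\to G$, with $\mathbb{R}^d$ regarded as an additive Lie group, is an OPS homomorphism if it is smooth and if $f\circ\gamma$ is a one-parameter subgroup of $G$ for every one-parameter subgroup $\gamma$ of $\mathbb{R}^d$. Let $d\ge 0$ and let $G$ be a matrix Lie group with Lie algebra $\mathfrak{g}$. 1. If $f:\mathbb{R}^d\to G$ is an OPS homomorphism, then there exists a unique real-linear map $\mathcal{M}:\mathbb{R}^d\to\mathfrak{g}$ such that $f(x)=\exp(\mathcal{M}(x))$ for all $x\in\mathbb{R}^d$. 2. Conversely,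 for every real-linear map $\mathcal{M}:\mathbb{R}^d\to\mathfrak{g}$ the formula $f(x)=\exp(\mathcal{M}(x))$ defines a map $f:\mathbb{R}^d\to G$, and $f$ is an OPS homomorphism. 3. Consequently, the OPS homomorphisms from $\mathbb{R}^d$ to the unitary group $U(\mathbb{C}^n)$ are exactly the unitary encodings $U(x)=e^{-i\mathcal{L}(x)}$, where $\mathcal{L}$ is a real-linear map from $\mathbb{R}^d$ to the complex $n\times n$ matrices such that $\mathcal{L}(x)$ is self-adjoint for each $x$: every such $\mathcal{L}$ defines in this way an OPS homomorphism with values in $U(\mathbb{C}^n)$, and every OPS homomorphism $U:\mathbb{R}^d\to U(\mathbb{C}^n)$ is of this form for a unique such $\mathcal{L}$. -/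

import Mathlib

open scoped Matrix ContDiff

/-- A (complex) matrix Lie group: a subgroup of `GL(m, ℂ)` that is closed in `GL(m, ℂ)`. -/
abbrev MatrixLieGroup (m : ℕ) : Type := ClosedSubgroup (Matrix.GeneralLinearGroup (Fin m) ℂ)

/-- The matrix underlying an element of a matrix Lie group. -/
def MatrixLieGroup.toMatrix {m : ℕ} {G : MatrixLieGroup m} (g : G) : Matrix (Fin m) (Fin m) ℂ :=
  ((g : Matrix.GeneralLinearGroup (Fin m) ℂ) : Matrix (Fin m) (Fin m) ℂ)

/-- A map from a real normed space to a matrix Lie group is smooth. A matrix Lie group is an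
embedded submanifold of the real vector space of all complex matrices, so that smoothness of a map
into it is smoothness of all matrix entries. -/
def MatrixLieGroup.IsSmooth {E : Type*} [NormedAddCommGroup E] [NormedSpace ℝ E] {m : ℕ}
    {G : MatrixLieGroup m} (f : E → G) : Prop :=
  ∀ i j, ContDiff ℝ ∞ (fun x => toMatrix (f x) i j)

/-- The entrywise derivative of the curve `γ` at `0` exists and is the matrix `X`. -/
def MatrixLieGroup.HasVelocityAtZero {m : ℕ} {G : MatrixLieGroup m} (γ : ℝ → G)
    (X : Matrix (Fin m) (Fin m) ℂ) : Prop :=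
  ∀ i j, HasDerivAt (fun t => toMatrix (γ t) i j) (X i j) 0

/-- The Lie algebra `𝔤` of a matrix Lie group `G`, as a real vector space: the tangent space at the
identity, that is, the set of velocities at `0` of the smooth curves in `G` which pass through the
identity at time `0`. -/
def MatrixLieGroup.lieAlgebra {m : ℕ} (G : MatrixLieGroup m) :
    Submodule ℝ (Matrix (Fin m) (Fin m) ℂ) where
  carrier := {X | ∃ γ : ℝ → G, IsSmooth γ ∧ γ 0 = 1 ∧ HasVelocityAtZero γ X}
  zero_mem' := ⟨fun _ => 1, fun _ _ => contDiff_const, rfl, fun i j => by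
    simpa using hasDerivAt_const (0 : ℝ) (toMatrix (1 : G) i j)⟩
  add_mem' := by
    rintro X Y ⟨γ, hγ, hγ0, hγX⟩ ⟨δ, hδ, hδ0, hδY⟩
    have key : ∀ t i j, toMatrix (γ t * δ t) i j
        = ∑ k, toMatrix (γ t) i k * toMatrix (δ t) k j := by
      intro t i j
      simp [toMatrix, Matrix.mul_apply]
    have h1 : toMatrix (1 : G) = 1 := by simp [toMatrix]
    refine ⟨fun t => γ t * δ t, fun i j => ?_, by simp [hγ0, hδ0], fun i j => ?_⟩
    · simp only [key]
      exact ContDiff.sum fun k _ => (hγ i k).mul (hδ k j)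
    · simp only [key]
      have h := HasDerivAt.fun_sum (u := Finset.univ) fun k _ => (hγX i k).mul (hδY k j)
      refine h.congr_deriv ?_
      simp [hγ0, hδ0, h1, Finset.sum_add_distrib, Matrix.one_apply]
  smul_mem' := by
    rintro c X ⟨γ, hγ, hγ0, hγX⟩
    refine ⟨fun t => γ (c * t), fun i j => ?_, by simp [hγ0], fun i j => ?_⟩
    · exact (hγ i j).comp (contDiff_const.mul contDiff_id)
    · have h0 : HasDerivAt (fun s => toMatrix (γ s) i j) (X i j) (c * 0) := by
        simpa using hγX i j
      have h1 : HasDerivAt (fun t : ℝ => c * t) c 0 := by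
        simpa using (hasDerivAt_id (0 : ℝ)).const_mul c
      exact h0.scomp (0 : ℝ) h1

/-- A continuous one-parameter subgroup of a topological group. -/
structure IsOneParameterSubgroup {G : Type*} [Group G] [TopologicalSpace G] (γ : ℝ → G) :
    Prop where
  continuous : Continuous γ
  map_zero : γ 0 = 1
  map_add : ∀ s t, γ (s + t) = γ s * γ t

/-- A one-parameter subgroup (OPS) homomorphism from the additive Lie group `ℝᵈ` to a matrix Lie
group: a smooth map, not necessarily a group homomorphism, which sends every one-parameter subgroup
of `ℝᵈ` to a one-parameter subgroup. (`Multiplicative` is the additive group `ℝᵈ`, with its usual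
topology, written multiplicatively.) -/
structure IsOPSHom {d m : ℕ} {G : MatrixLieGroup m} (f : EuclideanSpace ℝ (Fin d) → G) :
    Prop where
  smooth : MatrixLieGroup.IsSmooth f
  map_ops : ∀ γ : ℝ → Multiplicative (EuclideanSpace ℝ (Fin d)),
    IsOneParameterSubgroup γ → IsOneParameterSubgroup (fun t => f (γ t).toAdd)

/-- The unitary group `U(ℂⁿ)` as a matrix Lie group. -/
def unitaryLieGroup (n : ℕ) : MatrixLieGroup n where
  carrier := {g | (g : Matrix (Fin n) (Fin n) ℂ) ∈ Matrix.unitaryGroup (Fin n) ℂ}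
  one_mem' := by simp [one_mem]
  mul_mem' := fun ha hb => by simpa using mul_mem ha hb
  inv_mem' := by
    intro g hg
    have h : ((g⁻¹ : Matrix.GeneralLinearGroup (Fin n) ℂ) : Matrix (Fin n) (Fin n) ℂ)
        = star (g : Matrix (Fin n) (Fin n) ℂ) :=
      Units.inv_eq_of_mul_eq_one_right (Matrix.mem_unitaryGroup_iff.mp hg)
    change ((g⁻¹ : Matrix.GeneralLinearGroup (Fin n) ℂ) : Matrix (Fin n) (Fin n) ℂ) ∈
      Matrix.unitaryGroup (Fin n) ℂ
    rw [h]
    exact Unitary.star_mem hg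
  isClosed' := (isClosed_unitary (R := Matrix (Fin n) (Fin n) ℂ)).preimage Units.continuous_val

/-! Along each line `t ↦ t • x` an OPS homomorphism is a one-parameter subgroup, hence the
exponential of its velocity (`eq_exp_of_map_add`). That velocity is the derivative of `f` at `0`
applied to `x`, so it is linear in `x`. Differentiating `exp (t • M x)` at `t = 0` recovers `M x`,
whence uniqueness. Conversely, `exp` maps the Lie algebra into the closed group `G` since `γ (1/n) ^
n → exp (γ' 0)`, and one-parameter subgroups of `ℝᵈ` are lines, on which `M` takes commuting values.
For the unitary group the Lie algebra is the skew-Hermitian matrices, that is, `-i` times the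
Hermitian ones. -/

section BanachAlgebra

variable {𝔸 : Type*} [NormedRing 𝔸] [NormedAlgebra ℝ 𝔸] [CompleteSpace 𝔸]

open Filter Topology

/-- The exponential of a Banach algebra has a differentiable right inverse near `1`. -/
theorem exists_local_log : ∃ g : 𝔸 → 𝔸, g 1 = 0 ∧ HasFDerivAt g (1 : 𝔸 →L[ℝ] 𝔸) 1 ∧
    ∀ᶠ y in 𝓝 (1 : 𝔸), NormedSpace.exp (g y) = y := by
  have h : HasStrictFDerivAt (NormedSpace.exp : 𝔸 → 𝔸)
      ((ContinuousLinearEquiv.refl ℝ 𝔸 : 𝔸 ≃L[ℝ] 𝔸) : 𝔸 →L[ℝ] 𝔸) 0 :=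
    hasStrictFDerivAt_exp_zero
  refine ⟨h.localInverse _ _ _, ?_, ?_, ?_⟩
  · simpa using h.localInverse_apply_image
  · have := h.to_localInverse.hasFDerivAt
    rw [NormedSpace.exp_zero] at this
    exact this
  · have := h.eventually_right_inverse
    rwa [NormedSpace.exp_zero] at this

/-- With `g` a local logarithm, `n • g (γ (1/n))` is a difference quotient of `g ∘ γ` at `0`, so it
tends to `X`; its exponential is eventually `γ (1/n) ^ n`. -/
theorem tendsto_pow_exp_of_hasDerivAt {γ : ℝ → 𝔸} {X : 𝔸} (h1 : γ 0 = 1)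
    (hγ : HasDerivAt γ X 0) :
    Tendsto (fun n : ℕ => γ (n : ℝ)⁻¹ ^ n) atTop (𝓝 (NormedSpace.exp X)) := by
  obtain ⟨g, hg1, hg, hexp⟩ := exists_local_log (𝔸 := 𝔸)
  have hinv : Tendsto (fun n : ℕ => (n : ℝ)⁻¹) atTop (𝓝 0) := tendsto_inv_atTop_nhds_zero_nat
  have hd : HasDerivAt (g ∘ γ) X 0 := by
    rw [← h1] at hg
    simpa using hg.comp_hasDerivAt (0 : ℝ) hγ
  have hlim : Tendsto (fun n : ℕ => (n : ℝ) • g (γ (n : ℝ)⁻¹)) atTop (𝓝 X) := by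
    have hne : Tendsto (fun n : ℕ => (n : ℝ)⁻¹) atTop (𝓝[≠] 0) := by
      refine tendsto_nhdsWithin_iff.mpr ⟨hinv, ?_⟩
      filter_upwards [eventually_gt_atTop 0] with n hn
      simp [hn.ne']
    have := (hasDerivAt_iff_tendsto_slope.mp hd).comp hne
    refine this.congr fun n => ?_
    simp [slope_def_module, h1, hg1]
  have hev : ∀ᶠ n : ℕ in atTop, NormedSpace.exp (g (γ (n : ℝ)⁻¹)) = γ (n : ℝ)⁻¹ := by
    have hc : Tendsto (fun n : ℕ => γ (n : ℝ)⁻¹) atTop (𝓝 1) := by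
      rw [← h1]
      exact hγ.continuousAt.tendsto.comp hinv
    exact hc.eventually hexp
  let _ : NormedAlgebra ℚ 𝔸 := NormedAlgebra.restrictScalars ℚ ℝ 𝔸
  refine ((NormedSpace.exp_continuous.tendsto X).comp hlim).congr' ?_
  filter_upwards [hev] with n hn
  rw [Function.comp_apply, Nat.cast_smul_eq_nsmul, NormedSpace.exp_nsmul, hn]

theorem eq_exp_of_map_add {A : ℝ → 𝔸} {X : 𝔸} (h0 : A 0 = 1)
    (hadd : ∀ s t, A (s + t) = A s * A t) (hA : HasDerivAt A X 0) :
    A 1 = NormedSpace.exp X := by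
  have hpow : ∀ (n : ℕ) (t : ℝ), A (n * t) = A t ^ n := by
    intro n t
    induction n with
    | zero => simp [h0]
    | succ n ih => rw [Nat.cast_succ, add_mul, one_mul, hadd, ih, pow_succ]
  -- For `n > 0` the power `A (1/n) ^ n` is constantly `A 1`.
  refine tendsto_nhds_unique (tendsto_const_nhds.congr' ?_) (tendsto_pow_exp_of_hasDerivAt h0 hA)
  filter_upwards [eventually_gt_atTop 0] with n hn
  rw [← hpow, mul_inv_cancel₀ (by exact_mod_cast hn.ne')]

theorem hasDerivAt_exp_smul_zero (X : 𝔸) :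
    HasDerivAt (fun t : ℝ => NormedSpace.exp (t • X)) X 0 := by
  simpa using hasDerivAt_exp_smul_const (𝕂 := ℝ) X (0 : ℝ)

theorem eq_of_exp_smul_eq {X Y : 𝔸}
    (h : ∀ t : ℝ, NormedSpace.exp (t • X) = NormedSpace.exp (t • Y)) : X = Y := by
  have hX := hasDerivAt_exp_smul_zero X
  simp only [h] at hX
  exact hX.unique (hasDerivAt_exp_smul_zero Y)

end BanachAlgebra

namespace MatrixLieGroup

open Filter Topology
open scoped Matrix.Norms.Operator

variable {m : ℕ}

theorem hasDerivAt_matrix {A : ℝ → Matrix (Fin m) (Fin m) ℂ} {X : Matrix (Fin m) (Fin m) ℂ}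
    {t : ℝ} (h : ∀ i j, HasDerivAt (fun s => A s i j) (X i j) t) : HasDerivAt A X t := by
  have key : ∀ M : Matrix (Fin m) (Fin m) ℂ,
      M = ∑ i, ∑ j, M i j • Matrix.single i j (1 : ℂ) := fun M => by
    conv_lhs => rw [Matrix.matrix_eq_sum_single M]
    simp [Matrix.smul_single]
  rw [key X, funext fun s => key (A s)]
  exact HasDerivAt.fun_sum fun i _ => HasDerivAt.fun_sum fun j _ => (h i j).smul_const _

theorem contDiff_entry (i j : Fin m) :
    ContDiff ℝ ∞ (fun M : Matrix (Fin m) (Fin m) ℂ => M i j) :=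
  (LinearMap.toContinuousLinearMap (Matrix.entryLinearMap ℝ ℂ i j)).contDiff

theorem contDiff_exp : ContDiff ℝ ∞
    (NormedSpace.exp : Matrix (Fin m) (Fin m) ℂ → Matrix (Fin m) (Fin m) ℂ) :=
  contDiff_iff_contDiffAt.mpr fun x => (NormedSpace.exp_analytic (𝕂 := ℝ) x).contDiffAt

theorem tendsto_pow_exp {A : ℝ → Matrix (Fin m) (Fin m) ℂ} {X : Matrix (Fin m) (Fin m) ℂ}
    (h1 : A 0 = 1) (h : ∀ i j, HasDerivAt (fun s => A s i j) (X i j) 0) :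
    Tendsto (fun n : ℕ => A (n : ℝ)⁻¹ ^ n) atTop (𝓝 (NormedSpace.exp X)) :=
  tendsto_pow_exp_of_hasDerivAt h1 (hasDerivAt_matrix h)

theorem map_one_eq_exp {A : ℝ → Matrix (Fin m) (Fin m) ℂ} {X : Matrix (Fin m) (Fin m) ℂ}
    (h0 : A 0 = 1) (hadd : ∀ s t, A (s + t) = A s * A t)
    (h : ∀ i j, HasDerivAt (fun s => A s i j) (X i j) 0) :
    A 1 = NormedSpace.exp X :=
  eq_exp_of_map_add h0 hadd (hasDerivAt_matrix h)

theorem matrix_eq_of_exp_smul_eq {X Y : Matrix (Fin m) (Fin m) ℂ}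
    (h : ∀ t : ℝ, NormedSpace.exp (t • X) = NormedSpace.exp (t • Y)) : X = Y :=
  eq_of_exp_smul_eq h

theorem isEmbedding_unitsVal :
    IsEmbedding (Units.val : Matrix.GeneralLinearGroup (Fin m) ℂ → Matrix (Fin m) (Fin m) ℂ) :=
  Units.isOpenEmbedding_val.isEmbedding

theorem hasDerivAt_exp_smul_entry (X : Matrix (Fin m) (Fin m) ℂ) (i j : Fin m) :
    HasDerivAt (fun t : ℝ => (NormedSpace.exp (t • X)) i j) (X i j) 0 :=
  (LinearMap.toContinuousLinearMap (Matrix.entryLinearMap ℝ ℂ i j)).hasFDerivAt.comp_hasDerivAt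
    (0 : ℝ) (hasDerivAt_exp_smul_zero X)

theorem contDiff_exp_entry {E : Type*} [NormedAddCommGroup E] [NormedSpace ℝ E]
    [FiniteDimensional ℝ E] (M : E →ₗ[ℝ] Matrix (Fin m) (Fin m) ℂ) (i j : Fin m) :
    ContDiff ℝ ∞ (fun x => (NormedSpace.exp (M x)) i j) :=
  (contDiff_entry i j).comp (contDiff_exp.comp (LinearMap.toContinuousLinearMap M).contDiff)

/-- The powers `γ (1/n) ^ n` stay in `G`. Their limit `exp X` is invertible, so the convergence
holds in `GL`, where `G` is closed. -/
theorem exists_toMatrix_eq_exp {G : MatrixLieGroup m} {X : Matrix (Fin m) (Fin m) ℂ}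
    (hX : X ∈ G.lieAlgebra) : ∃ g : G, toMatrix g = NormedSpace.exp X := by
  obtain ⟨γ, -, h0, hv⟩ := hX
  let u : Matrix.GeneralLinearGroup (Fin m) ℂ := (Matrix.isUnit_exp X).unit
  have hu : (u : Matrix (Fin m) (Fin m) ℂ) = NormedSpace.exp X := rfl
  have hlim : Tendsto (fun n : ℕ => ((γ (n : ℝ)⁻¹ ^ n : G) : Matrix.GeneralLinearGroup (Fin m) ℂ))
      atTop (𝓝 u) := by
    rw [isEmbedding_unitsVal.tendsto_nhds_iff, hu]
    refine (tendsto_pow_exp (A := fun t => toMatrix (γ t)) (by simp [h0, toMatrix]) hv).congr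
      fun n => ?_
    simp [toMatrix]
  have hmem : u ∈ G := G.isClosed'.mem_of_tendsto hlim (Eventually.of_forall fun n => Subtype.prop _)
  exact ⟨⟨u, hmem⟩, hu⟩

theorem toMatrix_injective {G : MatrixLieGroup m} :
    Function.Injective (toMatrix : G → Matrix (Fin m) (Fin m) ℂ) :=
  Units.val_injective.comp Subtype.val_injective

theorem toMatrix_mul {G : MatrixLieGroup m} (g h : G) :
    toMatrix (g * h) = toMatrix g * toMatrix h := by simp [toMatrix]

theorem toMatrix_one {G : MatrixLieGroup m} : toMatrix (1 : G) = 1 := by simp [toMatrix]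

theorem isEmbedding_toMatrix {G : MatrixLieGroup m} :
    IsEmbedding (toMatrix : G → Matrix (Fin m) (Fin m) ℂ) :=
  isEmbedding_unitsVal.comp IsEmbedding.subtypeVal

end MatrixLieGroup

section OPS

open MatrixLieGroup

variable {d m : ℕ}

theorem isOneParameterSubgroup_smul (x : EuclideanSpace ℝ (Fin d)) :
    IsOneParameterSubgroup fun t : ℝ => Multiplicative.ofAdd (t • x) where
  continuous := continuous_ofAdd.comp (continuous_id.smul continuous_const)
  map_zero := by simp
  map_add s t := by rw [add_smul, ofAdd_add]

/-- A continuous additive map between real vector spaces such as these is real-linear. -/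
theorem IsOneParameterSubgroup.toAdd_eq_smul
    {γ : ℝ → Multiplicative (EuclideanSpace ℝ (Fin d))} (hγ : IsOneParameterSubgroup γ) (t : ℝ) :
    (γ t).toAdd = t • (γ 1).toAdd := by
  let φ : ℝ →+ EuclideanSpace ℝ (Fin d) :=
    { toFun := fun t => (γ t).toAdd
      map_zero' := by simp [hγ.map_zero]
      map_add' := fun s t => by simp [hγ.map_add] }
  have hφ : Continuous φ := continuous_toAdd.comp hγ.continuous
  have := (φ.toRealLinearMap hφ).map_smul t 1
  simpa [φ] using this

theorem IsOPSHom.isOneParameterSubgroup_comp_smul {G : MatrixLieGroup m}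
    {f : EuclideanSpace ℝ (Fin d) → G} (hf : IsOPSHom f) (x : EuclideanSpace ℝ (Fin d)) :
    IsOneParameterSubgroup fun t : ℝ => f (t • x) :=
  hf.map_ops _ (isOneParameterSubgroup_smul x)

theorem IsOPSHom.exists_linearMap {G : MatrixLieGroup m}
    {f : EuclideanSpace ℝ (Fin d) → G} (hf : IsOPSHom f) :
    ∃ M : EuclideanSpace ℝ (Fin d) →ₗ[ℝ] G.lieAlgebra,
      ∀ x, toMatrix (f x) = NormedSpace.exp (M x : Matrix (Fin m) (Fin m) ℂ) := by
  -- The derivative of `f` at `0`, taken entrywise.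
  let D : EuclideanSpace ℝ (Fin d) →ₗ[ℝ] Matrix (Fin m) (Fin m) ℂ :=
    { toFun := fun x => Matrix.of fun i j => fderiv ℝ (fun y => toMatrix (f y) i j) 0 x
      map_add' := fun x y => by ext i j; simp
      map_smul' := fun c x => by ext i j; simp }
  have hvel : ∀ x, HasVelocityAtZero (fun t : ℝ => f (t • x)) (D x) := by
    intro x i j
    have h1 : HasFDerivAt (fun y => toMatrix (f y) i j)
        (fderiv ℝ (fun y => toMatrix (f y) i j) 0) ((0 : ℝ) • x) := by
      rw [zero_smul]
      exact ((hf.smooth i j).differentiable (by simp) 0).hasFDerivAt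
    have h2 : HasDerivAt (fun t : ℝ => t • x) x 0 := by
      simpa using (hasDerivAt_id (0 : ℝ)).smul_const x
    exact h1.comp_hasDerivAt (0 : ℝ) h2
  have hmem : ∀ x, D x ∈ G.lieAlgebra := fun x =>
    ⟨fun t => f (t • x),
      fun i j => (hf.smooth i j).comp (contDiff_id.smul contDiff_const),
      (hf.isOneParameterSubgroup_comp_smul x).map_zero, hvel x⟩
  refine ⟨D.codRestrict _ hmem, fun x => ?_⟩
  have hops := hf.isOneParameterSubgroup_comp_smul x
  have := map_one_eq_exp (A := fun t : ℝ => toMatrix (f (t • x))) (X := D x)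
    (by rw [hops.map_zero, toMatrix_one])
    (fun s t => by rw [hops.map_add, toMatrix_mul]) (hvel x)
  simpa using this

/-- `exp` is not injective, but replacing `x` by `t • x` gives equality along whole lines, which
determines the generators. -/
theorem linearMap_eq_of_exp_eq {E : Type*} [AddCommGroup E] [Module ℝ E]
    {M N : E →ₗ[ℝ] Matrix (Fin m) (Fin m) ℂ}
    (h : ∀ x, NormedSpace.exp (M x) = NormedSpace.exp (N x)) : M = N := by
  ext1 x
  refine matrix_eq_of_exp_smul_eq fun t => ?_
  rw [← map_smul, ← map_smul, h]

theorem exists_isOPSHom_of_linearMap {G : MatrixLieGroup m}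
    (M : EuclideanSpace ℝ (Fin d) →ₗ[ℝ] G.lieAlgebra) :
    ∃ f : EuclideanSpace ℝ (Fin d) → G,
      (∀ x, toMatrix (f x) = NormedSpace.exp (M x : Matrix (Fin m) (Fin m) ℂ)) ∧ IsOPSHom f := by
  choose f hf using fun x => exists_toMatrix_eq_exp (M x).2
  have hsmooth : IsSmooth f := fun i j => by
    simp only [hf]
    exact contDiff_exp_entry (G.lieAlgebra.subtype.comp M) i j
  have hcont : Continuous f := isEmbedding_toMatrix.continuous_iff.mpr <|
    continuous_matrix fun i j => (hsmooth i j).continuous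
  refine ⟨f, hf, hsmooth, fun γ hγ => ⟨hcont.comp (continuous_toAdd.comp hγ.continuous), ?_, ?_⟩⟩
  · apply toMatrix_injective
    simp [hf, hγ.map_zero, toMatrix_one]
  · intro s t
    apply toMatrix_injective
    rw [toMatrix_mul, hf, hf, hf, hγ.map_add, toAdd_mul, map_add, Submodule.coe_add]
    refine Matrix.exp_add_of_commute _ _ ?_
    -- Both exponents are real multiples of the single matrix `M (γ 1)`, so they commute.
    rw [hγ.toAdd_eq_smul s, hγ.toAdd_eq_smul t]
    simp only [map_smul, Submodule.coe_smul]
    exact ((Commute.refl _).smul_left s).smul_right t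

end OPS

section Unitary

open MatrixLieGroup

variable {n : ℕ}

/-- Differentiate `γ(t)ᴴ γ(t) = 1` at `t = 0`. -/
theorem conjTranspose_eq_neg_of_mem_lieAlgebra {X : Matrix (Fin n) (Fin n) ℂ}
    (hX : X ∈ (unitaryLieGroup n).lieAlgebra) : Xᴴ = -X := by
  obtain ⟨γ, -, h0, hv⟩ := hX
  ext i j
  have hunit : ∀ t, ∑ k, star (toMatrix (γ t) k i) * toMatrix (γ t) k j
      = (1 : Matrix (Fin n) (Fin n) ℂ) i j := by
    intro t
    have h : star (toMatrix (γ t)) * toMatrix (γ t) = 1 :=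
      Matrix.mem_unitaryGroup_iff'.mp (γ t).2
    rw [← h, Matrix.mul_apply]
    rfl
  have hd : HasDerivAt (fun t => ∑ k, star (toMatrix (γ t) k i) * toMatrix (γ t) k j)
      (∑ k, (star (X k i) * toMatrix (γ 0) k j + star (toMatrix (γ 0) k i) * X k j)) 0 :=
    HasDerivAt.fun_sum fun k _ => ((hv k i).star).mul (hv k j)
  rw [funext hunit] at hd
  have hsum := hd.unique (hasDerivAt_const _ _)
  simp only [h0, toMatrix_one, Matrix.one_apply, Finset.sum_add_distrib, mul_ite, mul_one,
    mul_zero, apply_ite star, star_one, star_zero, ite_mul, one_mul, zero_mul,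
    Finset.sum_ite_eq', Finset.mem_univ, if_true] at hsum
  exact eq_neg_of_add_eq_zero_left hsum

/-- The curve `exp (t • X)` is unitary, because its adjoint is `exp (-t • X)`, its inverse. -/
theorem mem_lieAlgebra_of_conjTranspose_eq_neg {X : Matrix (Fin n) (Fin n) ℂ} (hX : Xᴴ = -X) :
    X ∈ (unitaryLieGroup n).lieAlgebra := by
  have hmem : ∀ t : ℝ, NormedSpace.exp (t • X) ∈ Matrix.unitaryGroup (Fin n) ℂ := by
    intro t
    rw [Matrix.mem_unitaryGroup_iff', Matrix.star_eq_conjTranspose, ← Matrix.exp_conjTranspose,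
      Matrix.conjTranspose_smul, hX, star_trivial, smul_neg, Matrix.exp_neg]
    exact Matrix.nonsing_inv_mul _ ((Matrix.isUnit_iff_isUnit_det _).mp (Matrix.isUnit_exp _))
  refine ⟨fun t => ⟨(Matrix.isUnit_exp (t • X)).unit, hmem t⟩, fun i j => ?_, ?_, fun i j => ?_⟩
  · exact contDiff_exp_entry (LinearMap.toSpanSingleton ℝ _ X) i j
  · apply toMatrix_injective
    simp [toMatrix]
  · exact hasDerivAt_exp_smul_entry X i j

end Unitary

theorem corollaryA4 :
    -- every OPS homomorphism is `exp ∘ M` for a unique linear `M`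
    (∀ (d m : ℕ) (G : MatrixLieGroup m) (f : EuclideanSpace ℝ (Fin d) → G), IsOPSHom f →
      ∃! M : EuclideanSpace ℝ (Fin d) →ₗ[ℝ] G.lieAlgebra,
        ∀ x, MatrixLieGroup.toMatrix (f x) = NormedSpace.exp (M x : Matrix (Fin m) (Fin m) ℂ)) ∧
    -- every linear `M` gives a well-defined map `exp ∘ M` into `G`, and it is an OPS homomorphism
    (∀ (d m : ℕ) (G : MatrixLieGroup m) (M : EuclideanSpace ℝ (Fin d) →ₗ[ℝ] G.lieAlgebra),
      ∃ f : EuclideanSpace ℝ (Fin d) → G,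
        (∀ x, MatrixLieGroup.toMatrix (f x) =
          NormedSpace.exp (M x : Matrix (Fin m) (Fin m) ℂ)) ∧ IsOPSHom f) ∧
    -- the OPS homomorphisms into the unitary group are exactly the encodings `x ↦ exp (-i L x)`
    (∀ (d n : ℕ) (U : EuclideanSpace ℝ (Fin d) → unitaryLieGroup n), IsOPSHom U →
      ∃! L : EuclideanSpace ℝ (Fin d) →ₗ[ℝ] Matrix (Fin n) (Fin n) ℂ,
        (∀ x, (L x).IsHermitian) ∧
          ∀ x, MatrixLieGroup.toMatrix (U x) = NormedSpace.exp (-(Complex.I • L x))) ∧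
    (∀ (d n : ℕ) (L : EuclideanSpace ℝ (Fin d) →ₗ[ℝ] Matrix (Fin n) (Fin n) ℂ),
      (∀ x, (L x).IsHermitian) →
        ∃ U : EuclideanSpace ℝ (Fin d) → unitaryLieGroup n,
          (∀ x, MatrixLieGroup.toMatrix (U x) = NormedSpace.exp (-(Complex.I • L x))) ∧
            IsOPSHom U) := by
  refine ⟨fun d m G f hf => ?_, fun d m G M => exists_isOPSHom_of_linearMap M,
    fun d n U hU => ?_, fun d n L hL => ?_⟩
  · obtain ⟨M, hM⟩ := hf.exists_linearMap
    refine ⟨M, hM, fun N hN => ?_⟩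
    have h : G.lieAlgebra.subtype.comp N = G.lieAlgebra.subtype.comp M :=
      linearMap_eq_of_exp_eq fun x => (hN x).symm.trans (hM x)
    exact LinearMap.ext fun x => Subtype.ext (LinearMap.congr_fun h x)
  · obtain ⟨M, hM⟩ := hU.exists_linearMap
    have hI : ∀ X : Matrix (Fin n) (Fin n) ℂ, -(Complex.I • Complex.I • X) = X := fun X => by
      rw [smul_smul, Complex.I_mul_I, neg_one_smul, neg_neg]
    -- Solving `-i L = M` gives `L = i M`.
    refine ⟨Complex.I • (unitaryLieGroup n).lieAlgebra.subtype.comp M,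
      ⟨fun x => ?_, fun x => ?_⟩, fun N hN => ?_⟩
    · have := conjTranspose_eq_neg_of_mem_lieAlgebra (M x).2
      simp [Matrix.IsHermitian, Matrix.conjTranspose_smul, this]
    · simp [hI, hM]
    · have h : -(Complex.I • N) = (unitaryLieGroup n).lieAlgebra.subtype.comp M :=
        linearMap_eq_of_exp_eq fun x => (hN.2 x).symm.trans (hM x)
      rw [← h, smul_neg, smul_smul, Complex.I_mul_I, neg_one_smul, neg_neg]
  · have hmem : ∀ x, (-(Complex.I • L)) x ∈ (unitaryLieGroup n).lieAlgebra := fun x =>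
      mem_lieAlgebra_of_conjTranspose_eq_neg (by
        have := hL x
        simp [Matrix.conjTranspose_smul, this.eq])
    exact exists_isOPSHom_of_linearMap ((-(Complex.I • L)).codRestrict _ hmem)
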